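/- Let $n\ge 2$ be an integer, let $1<p<\infty$, and let $\|x\|_p=\bigl(\sum_{i=1}^n|x_i|^p\bigr)^{1/p}$ be the $\ell^p$ norm on $\mathbb{R}^n$. For $R>0$ let $\sigma_R$ be the uniform probability measure on the finite set $\mathbb{Z}^n\cap B_R(0)$, where $B_R(0)$ is the open Euclidean ball of radius $R$ around the origin in $\mathbb{R}^n$. Then $\|\cdot\|_p \bmod 1$ is equidistributed over $\mathbb{Z}^n$; that is, as $R\to\infty$, the push-forwards of $\sigma_R$ under the map $x\mapsto \|x\|_p \bmod 1\in\mathbb{R}/\mathbb{Z}$ converge weakly to the Haar probability measure $\lambda$ on $\mathbb{R}/\mathbb{Z}$. -/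

import Mathlib

open MeasureTheory Filter Topology

noncomputable section

/-- The points of the lattice `ℤ^n` in the Euclidean space `ℝ^n`. -/
def integerPoints (n : ℕ) : Set (EuclideanSpace ℝ (Fin n)) :=
  {x | ∀ i, ∃ m : ℤ, x i = (m : ℝ)}

/-- The normalized counting measure on the integer points of `B_R(0) ∩ D`, with `B_R(0)` the
Euclidean ball: each of these finitely many points gets the same mass, and the total mass is `1`
(the measure is `0` if there are no such points). -/
def ballCountingMeasure {n : ℕ} (D : Set (EuclideanSpace ℝ (Fin n))) (R : ℝ) :
    Measure (EuclideanSpace ℝ (Fin n)) :=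
  ProbabilityTheory.uniformOn (integerPoints n ∩ (Metric.ball 0 R ∩ D))

instance isFiniteMeasure_ballCountingMeasure {n : ℕ} (D : Set (EuclideanSpace ℝ (Fin n))) (R : ℝ) :
    IsFiniteMeasure (ballCountingMeasure D R) := by
  unfold ballCountingMeasure ProbabilityTheory.uniformOn
  infer_instance

/-- The push-forward `(F mod 1)_* σ_R^D` to the circle `ℝ/ℤ`. (The measure `σ_R^D` has finite
support, so every `F` is almost everywhere measurable for it.) -/
def pushforwardMod1 {n : ℕ} (D : Set (EuclideanSpace ℝ (Fin n)))
    (F : EuclideanSpace ℝ (Fin n) → ℝ) (R : ℝ) : FiniteMeasure UnitAddCircle :=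
  ⟨(ballCountingMeasure D R).map (fun x => (F x : UnitAddCircle)), inferInstance⟩

/-- `F mod 1 (ℤ^n)` is equidistributed, for `F` considered on the domain `D`: as `R → ∞`, the
measures `(F mod 1)_* σ_R^D` converge weakly to the Haar probability measure of the circle. -/
def EquidistributedMod1 {n : ℕ} (D : Set (EuclideanSpace ℝ (Fin n)))
    (F : EuclideanSpace ℝ (Fin n) → ℝ) : Prop :=
  Tendsto (pushforwardMod1 D F) atTop
    (𝓝 (⟨AddCircle.haarAddCircle, inferInstance⟩ : FiniteMeasure UnitAddCircle))

end

/-! By Weyl's criterion it suffices that the averages of `e(k‖z‖_p)`, `k ≠ 0`, over the integer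
points of the ball tend to 0. Slice the ball into lines `z = (t, y)`, `y` fixed. With `a = ‖y‖_p`
the phase is `k a G(|t|/a)`, where `G u = (1 + u^p)^(1/p)` has a continuous, strictly increasing
derivative `φ` on `[0, ∞)`, because `p > 1`.

On a block of `L` consecutive `t`, with `L` fixed and `a` large, the phase is almost linear with
slope `kφ(t/a)`, so the block sum is a bounded geometric sum unless that slope is close to an
integer. Strict monotonicity of `φ` makes such `t` rare, and each line contributes `o(a)`, uniformly
in its length `O(a)` (`exists_forall_norm_sum_expTwoPi_scaled_le`). Lines with `‖y‖_p < cR` are few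
and are bounded trivially; the others have `a` of order `R`. The total is `o(R^n)`
(`eventually_norm_sum_intBall_le`), against at least a constant times `R^n` points
(`le_card_intBall`). -/

/-! ### Exponential sums with almost linear phase -/

/-- The standard character `x ↦ exp (2πix)` of `ℝ/ℤ`, as a function on `ℝ`. -/
noncomputable def expTwoPi (x : ℝ) : ℂ := Complex.exp (Complex.I * ((2 * Real.pi * x : ℝ) : ℂ))

theorem norm_expTwoPi (x : ℝ) : ‖expTwoPi x‖ = 1 := by
  rw [expTwoPi, mul_comm]; exact Complex.norm_exp_ofReal_mul_I _

theorem expTwoPi_add (x y : ℝ) : expTwoPi (x + y) = expTwoPi x * expTwoPi y := by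
  rw [expTwoPi, expTwoPi, expTwoPi, ← Complex.exp_add]; congr 1; push_cast; ring

theorem expTwoPi_int (m : ℤ) : expTwoPi m = 1 := by
  rw [expTwoPi, Complex.exp_eq_one_iff]; exact ⟨m, by push_cast; ring⟩

theorem expTwoPi_nat_mul (j : ℕ) (x : ℝ) : expTwoPi (j * x) = expTwoPi x ^ j := by
  rw [expTwoPi, expTwoPi, ← Complex.exp_nat_mul]; congr 1; push_cast; ring

theorem norm_expTwoPi_sub_le (x y : ℝ) : ‖expTwoPi x - expTwoPi y‖ ≤ 2 * Real.pi * |x - y| := by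
  have h : expTwoPi x - expTwoPi y = expTwoPi y * (expTwoPi (x - y) - 1) := by
    rw [mul_sub, ← expTwoPi_add]; simp
  rw [h, norm_mul, norm_expTwoPi, one_mul]
  refine (Real.norm_exp_I_mul_ofReal_sub_one_le).trans ?_
  rw [Real.norm_eq_abs, abs_mul, abs_of_pos Real.two_pi_pos]

/-- The norm is `2|sin πr|` with `r = x - round x`, and Jordan's inequality `|sin s| ≥ (2/π)|s|`
applies since `|r| ≤ 1/2`. -/
theorem le_norm_expTwoPi_sub_one (x : ℝ) : 4 * |x - round x| ≤ ‖expTwoPi x - 1‖ := by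
  have h : expTwoPi x = expTwoPi (x - round x) := by
    conv_lhs => rw [← sub_add_cancel x (round x : ℝ), expTwoPi_add, expTwoPi_int, mul_one]
  have hr := abs_sub_round x
  rw [h, expTwoPi, Complex.norm_exp_I_mul_ofReal_sub_one, norm_mul, Real.norm_two,
    Real.norm_eq_abs]
  have h2 : 2 * Real.pi * (x - round x) / 2 = Real.pi * (x - round x) := by ring
  have h3 := Real.mul_abs_le_abs_sin (x := Real.pi * (x - round x)) (by
    rw [abs_mul, abs_of_pos Real.pi_pos]; nlinarith [Real.pi_pos])
  rw [abs_mul, abs_of_pos Real.pi_pos, ← mul_assoc, div_mul_cancel₀ _ Real.pi_pos.ne'] at h3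
  rw [h2]; linarith

theorem norm_sum_expTwoPi_linear_le (L : ℕ) (θ α η : ℝ) (hη : 0 < η) (h : η ≤ |α - round α|) :
    ‖∑ j ∈ Finset.range L, expTwoPi (θ + j * α)‖ ≤ 1 / (2 * η) := by
  have hlow : 4 * η ≤ ‖expTwoPi α - 1‖ := by linarith [le_norm_expTwoPi_sub_one α]
  have hne : expTwoPi α ≠ 1 := by
    intro h0; rw [h0, sub_self, norm_zero] at hlow; linarith
  simp_rw [expTwoPi_add, expTwoPi_nat_mul]
  rw [← Finset.mul_sum, norm_mul, norm_expTwoPi, one_mul, geom_sum_eq hne, norm_div]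
  have hup : ‖expTwoPi α ^ L - 1‖ ≤ 2 := by
    refine (norm_sub_le _ _).trans ?_
    rw [norm_pow, norm_expTwoPi]; norm_num
  calc _ ≤ 2 / (4 * η) := by gcongr
    _ = 1 / (2 * η) := by field_simp; norm_num

theorem norm_sum_expTwoPi_near_linear_le (L : ℕ) (u : ℕ → ℝ) (θ α η w : ℝ) (hη : 0 < η)
    (h : η ≤ |α - round α|) (hw : ∀ j < L, |u j - (θ + j * α)| ≤ w) :
    ‖∑ j ∈ Finset.range L, expTwoPi (u j)‖ ≤ 2 * Real.pi * L * w + 1 / (2 * η) := by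
  have h1 : ∑ j ∈ Finset.range L, expTwoPi (u j) =
      ∑ j ∈ Finset.range L, (expTwoPi (u j) - expTwoPi (θ + j * α)) +
        ∑ j ∈ Finset.range L, expTwoPi (θ + j * α) := by
    rw [← Finset.sum_add_distrib]; simp
  rw [h1]
  refine (norm_add_le _ _).trans (add_le_add ?_ (norm_sum_expTwoPi_linear_le L θ α η hη h))
  calc _ ≤ ∑ j ∈ Finset.range L, 2 * Real.pi * w := by
        refine norm_sum_le_of_le _ fun j hj => (norm_expTwoPi_sub_le _ _).trans ?_
        have := hw j (Finset.mem_range.1 hj)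
        gcongr
    _ = _ := by simp; ring

theorem norm_sum_range_sub_sum_range_shift_le {f : ℕ → ℂ} (hf : ∀ t, ‖f t‖ ≤ 1) (N j : ℕ) :
    ‖∑ t ∈ Finset.range N, f t - ∑ t ∈ Finset.range N, f (t + j)‖ ≤ 2 * j := by
  induction j with
  | zero => simp
  | succ j ih =>
    have h1 : ∑ t ∈ Finset.range N, f (t + (j + 1)) - ∑ t ∈ Finset.range N, f (t + j) =
        f (N + j) - f (0 + j) := by
      rw [← Finset.sum_range_sub (fun t => f (t + j)) N, ← Finset.sum_sub_distrib]
      refine Finset.sum_congr rfl fun t _ => ?_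
      rw [show t + (j + 1) = t + 1 + j by ring]
    have h2 : ‖f (N + j) - f (0 + j)‖ ≤ 2 :=
      (norm_sub_le _ _).trans (by linarith [hf (N + j), hf (0 + j)])
    have h3 : ∑ t ∈ Finset.range N, f t - ∑ t ∈ Finset.range N, f (t + (j + 1)) =
      (∑ t ∈ Finset.range N, f t - ∑ t ∈ Finset.range N, f (t + j)) -
        (f (N + j) - f (0 + j)) := by rw [← h1]; ring
    rw [h3]
    refine (norm_sub_le _ _).trans ?_
    push_cast; linarith

/-- Averaging over the shifts `j < L` reduces a long sum to blocks of length `L`; each shift costs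
at most `2j ≤ 2L` in end terms. -/
theorem mul_norm_sum_range_le {f : ℕ → ℂ} (hf : ∀ t, ‖f t‖ ≤ 1) (N L : ℕ) :
    L * ‖∑ t ∈ Finset.range N, f t‖ ≤
      2 * (L : ℝ) ^ 2 + ∑ t ∈ Finset.range N, ‖∑ j ∈ Finset.range L, f (t + j)‖ := by
  have h1 : (L : ℂ) * ∑ t ∈ Finset.range N, f t =
      ∑ j ∈ Finset.range L,
        (∑ t ∈ Finset.range N, f t - ∑ t ∈ Finset.range N, f (t + j)) +
      ∑ t ∈ Finset.range N, ∑ j ∈ Finset.range L, f (t + j) := by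
    rw [Finset.sum_comm (s := Finset.range N), ← Finset.sum_add_distrib]; simp
  have h2 : (L : ℝ) * ‖∑ t ∈ Finset.range N, f t‖ = ‖(L : ℂ) * ∑ t ∈ Finset.range N, f t‖ := by
    rw [norm_mul, Complex.norm_natCast]
  rw [h2, h1]
  refine (norm_add_le _ _).trans (add_le_add ?_ (norm_sum_le _ _))
  calc _ ≤ ∑ j ∈ Finset.range L, 2 * (L : ℝ) := by
        refine norm_sum_le_of_le _ fun j hj =>
          (norm_sum_range_sub_sum_range_shift_le hf N j).trans ?_
        have : (j : ℝ) ≤ L := by exact_mod_cast (Finset.mem_range.1 hj).le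
        linarith
    _ = _ := by simp; ring

/-! ### Phases with strictly increasing derivative -/

theorem card_le_of_forall_sub_le {s : Finset ℕ} {D : ℝ} (hD : 0 ≤ D)
    (h : ∀ x ∈ s, ∀ y ∈ s, x ≤ y → (y : ℝ) - x ≤ D) : (s.card : ℝ) ≤ D + 1 := by
  rcases s.eq_empty_or_nonempty with rfl | hs
  · simp; linarith
  have hle : s.min' hs ≤ s.max' hs := s.min'_le_max' hs
  have hsub : s ⊆ Finset.Icc (s.min' hs) (s.max' hs) := fun x hx =>
    Finset.mem_Icc.2 ⟨s.min'_le x hx, s.le_max' x hx⟩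
  have hc := Finset.card_le_card hsub
  rw [Nat.card_Icc] at hc
  have h1 := h _ (s.min'_mem hs) _ (s.max'_mem hs) hle
  have h2 : s.card + s.min' hs ≤ s.max' hs + 1 := by omega
  have h3 : (s.card : ℝ) + s.min' hs ≤ s.max' hs + 1 := by exact_mod_cast h2
  linarith

/-- Compactness: `φ v - φ u` is continuous and positive on the compact set of pairs with `u + δ ≤
v`, so it attains a positive minimum there. -/
theorem exists_pos_add_le_of_strictMonoOn {φ : ℝ → ℝ} {a b δ : ℝ}
    (hc : ContinuousOn φ (Set.Icc a b)) (hm : StrictMonoOn φ (Set.Icc a b)) (hδ : 0 < δ) :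
    ∃ η > 0, ∀ u ∈ Set.Icc a b, ∀ v ∈ Set.Icc a b, u + δ ≤ v → φ u + η ≤ φ v := by
  set K : Set (ℝ × ℝ) := (Set.Icc a b ×ˢ Set.Icc a b) ∩ {q | q.1 + δ ≤ q.2} with hK
  have hKc : IsCompact K :=
    (isCompact_Icc.prod isCompact_Icc).inter_right (isClosed_le (by fun_prop) (by fun_prop))
  rcases K.eq_empty_or_nonempty with he | hne
  · refine ⟨1, one_pos, fun u hu v hv huv => ?_⟩
    have : (u, v) ∈ K := ⟨⟨hu, hv⟩, huv⟩
    simp [he] at this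
  have hcont : ContinuousOn (fun q : ℝ × ℝ => φ q.2 - φ q.1) K := by
    refine ContinuousOn.sub ?_ ?_
    · exact hc.comp continuous_snd.continuousOn fun q hq => hq.1.2
    · exact hc.comp continuous_fst.continuousOn fun q hq => hq.1.1
  obtain ⟨q, hq, hmin⟩ := hKc.exists_isMinOn hne hcont
  refine ⟨φ q.2 - φ q.1, sub_pos.2 (hm hq.1.1 hq.1.2 ?_), fun u hu v hv huv => ?_⟩
  · have : q.1 + δ ≤ q.2 := hq.2
    linarith
  · have : φ q.2 - φ q.1 ≤ φ v - φ u := hmin (show (u, v) ∈ K from ⟨⟨hu, hv⟩, huv⟩)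
    linarith

/-- Mean value inequality for `x ↦ G x - x φ(t/a)`, whose derivative `φ x - φ(t/a)` is at most `ω`
in absolute value on the interval. -/
theorem abs_scaled_sub_linear_le {G φ : ℝ → ℝ} {M a t s ω ρ : ℝ}
    (hG : ∀ u, 0 ≤ u → HasDerivAt G (φ u) u)
    (hφ : ∀ u ∈ Set.Icc 0 M, ∀ v ∈ Set.Icc 0 M, |u - v| < ρ → |φ u - φ v| ≤ ω)
    (ha : 0 < a) (ht : 0 ≤ t) (hs : 0 ≤ s) (hM : t + s ≤ M * a) (hsρ : s < ρ * a) :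
    |a * G ((t + s) / a) - (a * G (t / a) + s * φ (t / a))| ≤ s * ω := by
  have hu : 0 ≤ t / a := by positivity
  have hv : (t + s) / a ≤ M := by rw [div_le_iff₀ ha]; exact hM
  have huv : t / a ≤ (t + s) / a := by gcongr; linarith
  have key := (convex_Icc (t / a) ((t + s) / a)).norm_image_sub_le_of_norm_hasDerivWithin_le
    (f := fun x => G x - x * φ (t / a)) (f' := fun x => φ x - φ (t / a)) (C := ω)
    (fun x hx => by
      have h1 := (hG x (hu.trans hx.1)).sub ((hasDerivAt_id x).mul_const (φ (t / a)))
      simp only [one_mul] at h1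
      exact h1.hasDerivWithinAt)
    (fun x hx => by
      rw [Real.norm_eq_abs]
      refine hφ x ⟨hu.trans hx.1, hx.2.trans hv⟩ _ ⟨hu, huv.trans hv⟩ ?_
      rw [abs_of_nonneg (by linarith [hx.1])]
      have : x - t / a ≤ s / a := by
        have := hx.2; rw [add_div] at this; linarith
      refine this.trans_lt ?_
      rwa [div_lt_iff₀ ha])
    (Set.left_mem_Icc.2 huv) (Set.right_mem_Icc.2 huv)
  rw [Real.norm_eq_abs, Real.norm_eq_abs, abs_of_nonneg (by linarith : 0 ≤ (t + s) / a - t / a)]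
    at key
  have e1 : a * G ((t + s) / a) - (a * G (t / a) + s * φ (t / a)) =
      a * (G ((t + s) / a) - (t + s) / a * φ (t / a) - (G (t / a) - t / a * φ (t / a))) := by
    field_simp; ring
  have e2 : ω * ((t + s) / a - t / a) = s * ω / a := by field_simp; ring
  rw [e1, abs_mul, abs_of_pos ha]
  rw [e2] at key
  calc _ ≤ a * (s * ω / a) := by gcongr
    _ = s * ω := by field_simp

/-- Two such `t` further apart than `δ a` would have slopes differing by at least `|k| η₀ ≥ 2η`, yet
both lie within `η` of `m`. -/
theorem card_filter_near_int_le {φ : ℝ → ℝ} {k M a δ η η₀ : ℝ} {N : ℕ} (m : ℤ)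
    (hk : 2 * η ≤ |k| * η₀) (ha : 0 < a) (hδ : 0 ≤ δ)
    (hsep : ∀ u ∈ Set.Icc 0 M, ∀ v ∈ Set.Icc 0 M, u + δ ≤ v → φ u + η₀ ≤ φ v)
    (hη₀ : 0 < η₀) (hN : (N : ℝ) ≤ M * a) :
    (((Finset.range N).filter fun t : ℕ => |k * φ (t / a) - m| < η).card : ℝ) ≤ δ * a + 1 := by
  refine card_le_of_forall_sub_le (by positivity) fun x hx y hy _ => ?_
  rw [Finset.mem_filter, Finset.mem_range] at hx hy
  have hmem : ∀ z : ℕ, z < N → (z : ℝ) / a ∈ Set.Icc 0 M := fun z hz => by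
    have : (z : ℝ) ≤ N := by exact_mod_cast hz.le
    exact ⟨by positivity, by rw [div_le_iff₀ ha]; linarith⟩
  by_contra! hcon
  have h1 := hsep _ (hmem x hx.1) _ (hmem y hy.1) (by
    rw [← sub_nonneg]
    have : (y : ℝ) / a - (x / a + δ) = (y - x - δ * a) / a := by field_simp; ring
    rw [this]; apply div_nonneg <;> linarith)
  have h2 : |k * φ (y / a) - k * φ (x / a)| < 2 * η := by
    have e : k * φ (y / a) - k * φ (x / a) = (k * φ (y / a) - m) - (k * φ (x / a) - m) := by ring
    rw [e]
    exact (abs_sub _ _).trans_lt (by linarith [hx.2, hy.2])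
  rw [← mul_sub, abs_mul, abs_of_nonneg (by linarith : 0 ≤ φ (y / a) - φ (x / a))] at h2
  have : |k| * η₀ ≤ |k| * (φ (y / a) - φ (x / a)) := by gcongr; linarith
  linarith

/-- An exponential sum with phase `t ↦ k a G(t/a)`, where `G'` is continuous and strictly
increasing, is `o(a)`, uniformly in its length `N = O(a)`. -/
theorem exists_forall_norm_sum_expTwoPi_scaled_le {G φ : ℝ → ℝ}
    (hG : ∀ u, 0 ≤ u → HasDerivAt G (φ u) u) (hφc : ContinuousOn φ (Set.Ici 0))
    (hφm : StrictMonoOn φ (Set.Ici 0)) {k : ℝ} (hk : k ≠ 0) {M ε : ℝ} (hM : 0 < M) (hε : 0 < ε) :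
    ∃ A > 0, ∀ a ≥ A, ∀ N : ℕ, (N : ℝ) ≤ M * a →
      ‖∑ t ∈ Finset.range N, expTwoPi (k * (a * G (t / a)))‖ ≤ ε * a := by
  -- The extra unit leaves room for the shifted points `t + j`, since `j < L ≤ a`.
  have hsub : Set.Icc 0 (M + 1) ⊆ Set.Ici (0 : ℝ) := fun x hx => hx.1
  have hφc' := hφc.mono hsub
  obtain ⟨B, hB⟩ := isCompact_Icc.exists_bound_of_continuousOn hφc'
  have hk' : 0 < |k| := abs_pos.2 hk
  -- Every integer nearest to a slope `kφ(t/a)` lies in `[-Z, Z]`.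
  set Z : ℤ := ⌈|k| * B⌉ + 1
  set ms : Finset ℤ := Finset.Icc (-Z) Z
  set Q : ℝ := (ms.card : ℝ)
  have hQ : 0 ≤ Q := Nat.cast_nonneg _
  set δ : ℝ := ε / (4 * (Q + 1)) with hδdef
  have hδ : 0 < δ := by positivity
  obtain ⟨η₀, hη₀, hsep⟩ :=
    exists_pos_add_le_of_strictMonoOn hφc' (hφm.mono hsub) hδ
  set η : ℝ := |k| * η₀ / 2 with hηdef
  have hη : 0 < η := by positivity
  -- `L` makes the geometric-sum error `M/(2η)` at most `Lε/8`; `ω` then makes the linearization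
  -- error, times `M`, equal to `Lε/8`.
  obtain ⟨L, hL⟩ := exists_nat_gt (4 * M / (η * ε))
  have hL0 : (0 : ℝ) < L := lt_trans (by positivity) hL
  set ω : ℝ := ε / (16 * Real.pi * M * (|k| * L)) with hωdef
  have hπ := Real.pi_pos
  have hω : 0 < ω := by positivity
  obtain ⟨ρ, hρ, huc⟩ := Metric.uniformContinuousOn_iff.1
    (isCompact_Icc.uniformContinuousOn_of_continuous hφc') ω hω
  -- The bounds on `a` give, in turn, room for the shifts, `L < ρ a` for uniform continuity, and `2L
  -- + Q ≤ εa/2`.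
  refine ⟨max (max 1 L) (max (2 * L / ρ) (2 * (2 * L + Q) / ε)), by positivity,
    fun a haA N hN => ?_⟩
  simp only [ge_iff_le, max_le_iff] at haA
  obtain ⟨⟨ha1, haL⟩, haρ, haε⟩ := haA
  have ha : 0 < a := by linarith
  rw [div_le_iff₀ hρ] at haρ
  rw [div_le_iff₀ hε] at haε
  have hN' : (N : ℝ) ≤ (M + 1) * a := by linarith
  set bad : ℕ → Prop := fun t => ∃ m ∈ ms, |k * φ (t / a) - m| < η
  classical
  have hcard : (((Finset.range N).filter bad).card : ℝ) ≤ Q * (δ * a + 1) := by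
    have hsubset : (Finset.range N).filter bad ⊆
        ms.biUnion fun m => (Finset.range N).filter fun t : ℕ => |k * φ (t / a) - m| < η := by
      intro t ht
      rw [Finset.mem_filter] at ht
      obtain ⟨ht, m, hm, h⟩ := ht
      exact Finset.mem_biUnion.2 ⟨m, hm, Finset.mem_filter.2 ⟨ht, h⟩⟩
    have h1 := (Finset.card_le_card hsubset).trans Finset.card_biUnion_le
    calc (((Finset.range N).filter bad).card : ℝ)
        ≤ ∑ m ∈ ms, (((Finset.range N).filter
            fun t : ℕ => |k * φ (t / a) - m| < η).card : ℝ) := by exact_mod_cast h1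
      _ ≤ ∑ m ∈ ms, (δ * a + 1) := Finset.sum_le_sum fun m _ =>
          card_filter_near_int_le m (by rw [hηdef]; linarith) ha hδ.le hsep hη₀ hN'
      _ = Q * (δ * a + 1) := by rw [Finset.sum_const, nsmul_eq_mul]
  set c : ℝ := 2 * Real.pi * L * (|k| * (L * ω)) + 1 / (2 * η) with hc
  have hc0 : 0 ≤ c := by positivity
  have hblock : ∀ t ∈ Finset.range N,
      ‖∑ j ∈ Finset.range L, expTwoPi (k * (a * G ((t + j : ℕ) / a)))‖ ≤
        (if bad t then (L : ℝ) else 0) + c := by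
    intro t ht
    have htN : (t : ℝ) ≤ N := by exact_mod_cast (Finset.mem_range.1 ht).le
    split_ifs with hb
    · have : ‖∑ j ∈ Finset.range L, expTwoPi (k * (a * G ((t + j : ℕ) / a)))‖ ≤ L := by
        refine (norm_sum_le _ _).trans ?_
        simp [norm_expTwoPi]
      linarith
    · rw [zero_add]
      refine norm_sum_expTwoPi_near_linear_le L _ (k * (a * G (t / a))) (k * φ (t / a)) η _ hη
        ?_ fun j hj => ?_
      · by_contra! hlt
        refine hb ⟨round (k * φ (t / a)), ?_, hlt⟩
        have h1 : |k * φ (t / a)| ≤ |k| * B := by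
          rw [abs_mul]
          have := hB (t / a) ⟨by positivity, by rw [div_le_iff₀ ha]; linarith⟩
          rw [Real.norm_eq_abs] at this
          gcongr
        have h2 := abs_sub_round (k * φ (t / a))
        have h3 : |((round (k * φ (t / a)) : ℤ) : ℝ)| ≤ (Z : ℤ) := by
          have h4 := Int.le_ceil (|k| * B)
          have h5 : |((round (k * φ (t / a)) : ℤ) : ℝ)| ≤
              |k * φ (t / a)| + |k * φ (t / a) - round (k * φ (t / a))| := by
            have := abs_sub (k * φ (t / a)) (k * φ (t / a) - round (k * φ (t / a)))
            rwa [sub_sub_cancel] at this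
          simp only [Z]
          push_cast
          linarith
        exact Finset.mem_Icc.2 (abs_le.1 (by exact_mod_cast h3))
      · have hjL : (j : ℝ) ≤ L := by exact_mod_cast hj.le
        have h1 := abs_scaled_sub_linear_le (M := M + 1) (a := a) (t := t) (s := j) hG
          (fun u hu v hv huv => (huc u hu v hv huv).le) ha (by positivity) (by positivity)
          (by linarith) (by linarith)
        have e : k * (a * G ((t + j : ℕ) / a)) - (k * (a * G (t / a)) + j * (k * φ (t / a))) =
            k * (a * G ((t + j) / a) - (a * G (t / a) + j * φ (t / a))) := by
          push_cast; ring
        rw [e, abs_mul]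
        gcongr
        exact h1.trans (by gcongr)
  have hmain := mul_norm_sum_range_le (f := fun t : ℕ => expTwoPi (k * (a * G (t / a))))
    (fun t => (norm_expTwoPi _).le) N L
  have hsum := Finset.sum_le_sum hblock
  rw [Finset.sum_add_distrib, ← Finset.sum_filter, Finset.sum_const, Finset.sum_const,
    Finset.card_range, nsmul_eq_mul, nsmul_eq_mul] at hsum
  have hNc : N * c ≤ L * (ε * a / 4) := by
    have h1 : M * (2 * Real.pi * L * (|k| * (L * ω))) = L * (ε / 8) := by
      rw [hωdef]; field_simp; norm_num
    have h2 : M * (1 / (2 * η)) ≤ L * (ε / 8) := by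
      rw [div_lt_iff₀ (by positivity)] at hL
      rw [mul_one_div, div_le_iff₀ (by positivity)]
      linarith
    have h3 : M * c ≤ L * (ε / 4) := by rw [hc, mul_add]; linarith
    calc N * c ≤ M * a * c := by gcongr
      _ = M * c * a := by ring
      _ ≤ L * (ε / 4) * a := by gcongr
      _ = _ := by ring
  have hQδ : Q * δ ≤ ε / 4 := by
    rw [hδdef, mul_div_assoc', div_le_div_iff₀ (by positivity) (by norm_num)]
    nlinarith
  have hQa : Q * (δ * a + 1) ≤ ε / 4 * a + Q := by
    have : Q * δ * a ≤ ε / 4 * a := by gcongr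
    linarith
  -- Budget, after division by `L`: `2L + Q ≤ εa/2`, bad blocks `εa/4`, good blocks `εa/4`.
  have hfin : L * ‖∑ t ∈ Finset.range N, expTwoPi (k * (a * G (t / a)))‖ ≤ L * (ε * a) := by
    have h4 : ((Finset.range N).filter bad).card * (L : ℝ) ≤ (ε / 4 * a + Q) * L := by
      have := hcard.trans hQa; gcongr
    have h5 : L * (2 * L + Q) ≤ L * (ε * a / 2) := by gcongr; linarith
    nlinarith
  exact le_of_mul_le_mul_left hfin hL0

/-! ### The profile of the `ℓ^p` norm along a line -/

/-- The derivative `u^(p-1) (1 + u^p)^(1/p - 1)` is rewritten so that `u` occurs once, which makes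
its monotonicity visible. -/
theorem hasDerivAt_one_add_rpow_root {p : ℝ} (hp : 1 < p) {u : ℝ} (hu : 0 ≤ u) :
    HasDerivAt (fun u : ℝ => (1 + u ^ p) ^ (1 / p)) ((1 - 1 / (1 + u ^ p)) ^ ((p - 1) / p)) u := by
  have hp0 : 0 < p := by linarith
  have hpos : 0 < 1 + u ^ p := by have := Real.rpow_nonneg hu p; linarith
  have h1 := ((Real.hasDerivAt_rpow_const (x := u) (p := p) (Or.inr hp.le)).const_add 1).rpow_const
    (p := 1 / p) (Or.inl hpos.ne')
  convert h1 using 1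
  have e : 1 - 1 / (1 + u ^ p) = u ^ p / (1 + u ^ p) := by field_simp; ring
  rw [e, Real.div_rpow (Real.rpow_nonneg hu p) hpos.le, ← Real.rpow_mul hu,
    show p * ((p - 1) / p) = p - 1 by field_simp,
    show 1 / p - 1 = -((p - 1) / p) by field_simp; ring, Real.rpow_neg hpos.le]
  field_simp

theorem strictMonoOn_one_sub_inv_rpow {p : ℝ} (hp : 1 < p) :
    StrictMonoOn (fun u : ℝ => (1 - 1 / (1 + u ^ p)) ^ ((p - 1) / p)) (Set.Ici 0) := by
  intro u hu v hv huv
  have hp0 : 0 < p := by linarith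
  have h0 := Real.rpow_nonneg (show 0 ≤ u from hu) p
  have h1 : u ^ p < v ^ p := Real.rpow_lt_rpow hu huv hp0
  have h2 : 1 / (1 + v ^ p) < 1 / (1 + u ^ p) :=
    one_div_lt_one_div_of_lt (by linarith) (by linarith)
  have h3 : 1 / (1 + u ^ p) ≤ 1 := by rw [div_le_one (by linarith)]; linarith
  exact Real.rpow_lt_rpow (by linarith) (by linarith) (div_pos (by linarith) hp0)

theorem continuousOn_one_sub_inv_rpow {p : ℝ} (hp : 1 < p) :
    ContinuousOn (fun u : ℝ => (1 - 1 / (1 + u ^ p)) ^ ((p - 1) / p)) (Set.Ici 0) := by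
  have hp0 : 0 < p := by linarith
  refine ContinuousOn.rpow_const ?_ fun _ _ => Or.inr (div_nonneg (by linarith) hp0.le)
  refine continuousOn_const.sub (continuousOn_const.div ?_ fun u hu => ?_)
  · exact continuousOn_const.add (continuousOn_id.rpow_const fun _ _ => Or.inr hp0.le)
  · have := Real.rpow_nonneg (show 0 ≤ u from hu) p
    positivity

/-- The `ℓ^p` norm of an integer vector. -/
noncomputable def intLpNorm (p : ℝ) {n : ℕ} (z : Fin n → ℤ) : ℝ :=
  (∑ i, |(z i : ℝ)| ^ p) ^ (1 / p)

theorem abs_le_intLpNorm {p : ℝ} (hp : 0 < p) {n : ℕ} (z : Fin n → ℤ) (i : Fin n) :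
    |(z i : ℝ)| ≤ intLpNorm p z := by
  have h : |(z i : ℝ)| ^ p ≤ ∑ i, |(z i : ℝ)| ^ p :=
    Finset.single_le_sum (f := fun i => |(z i : ℝ)| ^ p) (fun _ _ => by positivity)
      (Finset.mem_univ i)
  calc |(z i : ℝ)| = (|(z i : ℝ)| ^ p) ^ (1 / p) := by
        rw [← Real.rpow_mul (abs_nonneg _), mul_one_div_cancel hp.ne', Real.rpow_one]
    _ ≤ _ := Real.rpow_le_rpow (by positivity) h (by positivity)

theorem intLpNorm_le {p : ℝ} (hp : 1 ≤ p) {n : ℕ} (hn : 1 ≤ n) {z : Fin n → ℤ} {B : ℝ}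
    (hB : 0 ≤ B) (h : ∀ i, |(z i : ℝ)| ≤ B) : intLpNorm p z ≤ n * B := by
  have hp0 : 0 < p := by linarith
  have hn' : (1 : ℝ) ≤ n := by exact_mod_cast hn
  have h1 : ∑ i, |(z i : ℝ)| ^ p ≤ (n * B) ^ p := by
    calc ∑ i, |(z i : ℝ)| ^ p ≤ ∑ i : Fin n, B ^ p :=
          Finset.sum_le_sum fun i _ => Real.rpow_le_rpow (abs_nonneg _) (h i) hp0.le
      _ = n * B ^ p := by simp
      _ ≤ (n : ℝ) ^ p * B ^ p := by
          gcongr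
          simpa using Real.rpow_le_rpow_of_exponent_le hn' hp
      _ = _ := (Real.mul_rpow (by positivity) hB).symm
  calc intLpNorm p z ≤ ((n * B) ^ p) ^ (1 / p) :=
        Real.rpow_le_rpow (Finset.sum_nonneg fun _ _ => by positivity) h1 (by positivity)
    _ = _ := by rw [← Real.rpow_mul (by positivity), mul_one_div_cancel hp0.ne', Real.rpow_one]

theorem intLpNorm_cons {p : ℝ} (hp : 0 < p) {n : ℕ} (t : ℤ) (y : Fin n → ℤ)
    (hy : 0 < intLpNorm p y) :
    intLpNorm p (Fin.cons t y : Fin (n + 1) → ℤ) =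
      intLpNorm p y * (1 + ((t.natAbs : ℝ) / intLpNorm p y) ^ p) ^ (1 / p) := by
  have hs : 0 ≤ ∑ i, |(y i : ℝ)| ^ p := Finset.sum_nonneg fun _ _ => by positivity
  have ha : intLpNorm p y ^ p = ∑ i, |(y i : ℝ)| ^ p := by
    rw [intLpNorm, ← Real.rpow_mul hs, one_div_mul_cancel hp.ne', Real.rpow_one]
  have hap : 0 < intLpNorm p y ^ p := Real.rpow_pos_of_pos hy p
  have ht : (t.natAbs : ℝ) = |(t : ℝ)| := by rw [Nat.cast_natAbs, Int.cast_abs]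
  have h1 : intLpNorm p (Fin.cons t y : Fin (n + 1) → ℤ) =
      (|(t : ℝ)| ^ p + intLpNorm p y ^ p) ^ (1 / p) := by
    rw [ha, intLpNorm, Fin.sum_univ_succ]; simp
  have h2 : |(t : ℝ)| ^ p + intLpNorm p y ^ p =
      intLpNorm p y ^ p * (1 + ((t.natAbs : ℝ) / intLpNorm p y) ^ p) := by
    rw [Real.div_rpow (by positivity) hy.le, ht]; field_simp; ring
  rw [h1, h2, Real.mul_rpow hap.le (by positivity), ← Real.rpow_mul hy.le,
    mul_one_div_cancel hp.ne', Real.rpow_one]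

/-! ### Integer points of boxes and balls, and slicing into lines -/

/-- The integer vectors with all coordinates at most `⌈r⌉` in absolute value. -/
noncomputable def intBox (n : ℕ) (r : ℝ) : Finset (Fin n → ℤ) :=
  Fintype.piFinset fun _ => Finset.Icc (-⌈r⌉) ⌈r⌉

theorem mem_intBox_of_abs_le {n : ℕ} {r : ℝ} {z : Fin n → ℤ} (h : ∀ i, |(z i : ℝ)| ≤ r) :
    z ∈ intBox n r := by
  refine Fintype.mem_piFinset.2 fun i => Finset.mem_Icc.2 (abs_le.1 ?_)
  have := (h i).trans (Int.le_ceil r)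
  exact_mod_cast this

theorem abs_le_of_mem_intBox {n : ℕ} {r : ℝ} {z : Fin n → ℤ} (h : z ∈ intBox n r) (i : Fin n) :
    |(z i : ℝ)| ≤ r + 1 := by
  have h1 := abs_le.2 (Finset.mem_Icc.1 (Fintype.mem_piFinset.1 h i))
  have h2 : |(z i : ℝ)| ≤ ⌈r⌉ := by exact_mod_cast h1
  linarith [Int.ceil_lt_add_one r]

theorem card_intBox_le {n : ℕ} {r : ℝ} (hr : 1 ≤ r) : ((intBox n r).card : ℝ) ≤ (5 * r) ^ n := by
  have h0 : 0 ≤ ⌈r⌉ := Int.ceil_nonneg (by linarith)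
  rw [intBox, Fintype.card_piFinset]
  simp only [Int.card_Icc, Finset.prod_const, Finset.card_univ, Fintype.card_fin]
  push_cast
  gcongr
  have h1 : (((⌈r⌉ + 1 - -⌈r⌉).toNat : ℤ) : ℝ) = 2 * ⌈r⌉ + 1 := by
    rw [Int.toNat_of_nonneg (by omega)]; push_cast; ring
  rw [Int.cast_natCast] at h1
  rw [h1]
  -- `2⌈r⌉ + 1 < 2r + 3 ≤ 5r`, as `r ≥ 1`.
  linarith [Int.ceil_lt_add_one r]

open Classical in
/-- The integer vectors of Euclidean norm less than `R` (for `R ≥ 0`). -/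
noncomputable def intBall (n : ℕ) (R : ℝ) : Finset (Fin n → ℤ) :=
  (intBox n R).filter fun z => ∑ i, (z i : ℝ) ^ 2 < R ^ 2

theorem mem_intBall {n : ℕ} {R : ℝ} (hR : 0 ≤ R) {z : Fin n → ℤ} :
    z ∈ intBall n R ↔ ∑ i, (z i : ℝ) ^ 2 < R ^ 2 := by
  rw [intBall, Finset.mem_filter, and_iff_right_iff_imp]
  refine fun h => mem_intBox_of_abs_le fun i => abs_le_of_sq_le_sq ?_ hR
  exact (Finset.single_le_sum (f := fun i => (z i : ℝ) ^ 2) (fun _ _ => sq_nonneg _)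
    (Finset.mem_univ i)).trans h.le

theorem mem_Ioo_ceil_sqrt {t : ℤ} {c : ℝ} :
    t ∈ Finset.Ioo (-(⌈√c⌉₊ : ℤ)) ⌈√c⌉₊ ↔ (t : ℝ) ^ 2 < c := by
  have h1 : t ∈ Finset.Ioo (-(⌈√c⌉₊ : ℤ)) ⌈√c⌉₊ ↔ t.natAbs < ⌈√c⌉₊ := by
    rw [Finset.mem_Ioo]; omega
  rw [h1, Nat.lt_ceil, Real.lt_sqrt (by positivity), Nat.cast_natAbs, Int.cast_abs, sq_abs]

/-- The number of `t ≥ 0` with `(t, y)` in the ball of radius `R`. -/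
noncomputable def halfChord {n : ℕ} (R : ℝ) (y : Fin n → ℤ) : ℕ := ⌈√(R ^ 2 - ∑ i, (y i : ℝ) ^ 2)⌉₊

theorem halfChord_le {n : ℕ} {R : ℝ} (hR : 0 ≤ R) (y : Fin n → ℤ) : (halfChord R y : ℝ) ≤ R + 1 := by
  have h1 : √(R ^ 2 - ∑ i, (y i : ℝ) ^ 2) ≤ R := by
    rw [Real.sqrt_le_left hR]
    have : 0 ≤ ∑ i, (y i : ℝ) ^ 2 := Finset.sum_nonneg fun _ _ => sq_nonneg _
    linarith
  have := Nat.ceil_lt_add_one (Real.sqrt_nonneg (R ^ 2 - ∑ i, (y i : ℝ) ^ 2))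
  rw [halfChord]; linarith

/-- All `y` in the box may be kept: if the line misses the ball, the square root of a nonpositive
number is 0 and the inner sum is empty. -/
theorem sum_intBall_succ {n : ℕ} {R : ℝ} (hR : 0 ≤ R) (h : (Fin (n + 1) → ℤ) → ℂ) :
    ∑ z ∈ intBall (n + 1) R, h z =
      ∑ y ∈ intBox n R, ∑ t ∈ Finset.Ioo (-(halfChord R y : ℤ)) (halfChord R y),
        h (Fin.cons t y) := by
  have key : ∀ (t : ℤ) (y : Fin n → ℤ), (Fin.cons t y : Fin (n + 1) → ℤ) ∈ intBall (n + 1) R ↔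
      t ∈ Finset.Ioo (-(halfChord R y : ℤ)) (halfChord R y) := fun t y => by
    rw [mem_intBall hR, halfChord, mem_Ioo_ceil_sqrt, Fin.sum_univ_succ, lt_sub_iff_add_lt]
    simp
  rw [Finset.sum_sigma']
  refine Finset.sum_nbij' (fun z => ⟨Fin.tail z, z 0⟩) (fun q => Fin.cons q.2 q.1)
    (fun z hz => ?_) (fun q hq => ?_) (fun z _ => ?_) (fun q _ => ?_) (fun z _ => ?_)
  · refine Finset.mem_sigma.2 ⟨?_, ?_⟩
    · have := (Finset.mem_filter.1 hz).1
      exact Fintype.mem_piFinset.2 fun i => Fintype.mem_piFinset.1 this i.succ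
    · rw [← key, Fin.cons_self_tail]; exact hz
  · exact (key _ _).2 (Finset.mem_sigma.1 hq).2
  · simp
  · simp
  · simp

/-- Each `t ≠ 0` comes with both signs but `0` only once, hence the extra `h 0`. For an empty range
the identity would fail, hence `N + 1`. -/
theorem sum_Ioo_natAbs_add (h : ℕ → ℂ) (N : ℕ) :
    ∑ t ∈ Finset.Ioo (-((N + 1 : ℕ) : ℤ)) ((N + 1 : ℕ) : ℤ), h t.natAbs + h 0 =
      2 * ∑ t ∈ Finset.range (N + 1), h t := by
  induction N with
  | zero =>
    have : Finset.Ioo (-((0 + 1 : ℕ) : ℤ)) ((0 + 1 : ℕ) : ℤ) = {0} := by decide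
    rw [this]; simp; ring
  | succ N ih =>
    have : Finset.Ioo (-((N + 1 + 1 : ℕ) : ℤ)) ((N + 1 + 1 : ℕ) : ℤ) =
        insert ((N + 1 : ℕ) : ℤ) (insert (-((N + 1 : ℕ) : ℤ))
          (Finset.Ioo (-((N + 1 : ℕ) : ℤ)) ((N + 1 : ℕ) : ℤ))) := by
      ext x; simp only [Finset.mem_insert, Finset.mem_Ioo]; omega
    rw [this, Finset.sum_insert, Finset.sum_insert, Finset.sum_range_succ, mul_add, ← ih]
    · simp only [Int.natAbs_neg, Int.natAbs_natCast]; ring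
    · simp
    · simp only [Finset.mem_insert, Finset.mem_Ioo]; omega

theorem norm_sum_Ioo_natAbs_le {h : ℕ → ℂ} (h0 : ‖h 0‖ ≤ 1) (N : ℕ) :
    ‖∑ t ∈ Finset.Ioo (-(N : ℤ)) N, h t.natAbs‖ ≤ 2 * ‖∑ t ∈ Finset.range N, h t‖ + 1 := by
  rcases N with _ | N
  · simp
  rw [eq_sub_iff_add_eq.2 (sum_Ioo_natAbs_add h N)]
  refine (norm_sub_le _ _).trans ?_
  rw [norm_mul, Complex.norm_two]
  linarith

/-! ### Exponential sums over lines and over the ball -/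

theorem norm_sum_fiber_le_of_large {p : ℝ} (hp : 1 < p) {k : ℝ} (hk : k ≠ 0) {M ε : ℝ} (hM : 0 < M)
    (hε : 0 < ε) : ∃ A > 0, ∀ (n : ℕ) (y : Fin n → ℤ) (N : ℕ), A ≤ intLpNorm p y →
      (N : ℝ) ≤ M * intLpNorm p y →
      ‖∑ t ∈ Finset.Ioo (-(N : ℤ)) N, expTwoPi (k * intLpNorm p (Fin.cons t y : Fin (n + 1) → ℤ))‖ ≤
        2 * (ε * intLpNorm p y) + 1 := by
  obtain ⟨A, hA, h⟩ := exists_forall_norm_sum_expTwoPi_scaled_le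
    (fun u hu => hasDerivAt_one_add_rpow_root hp hu) (continuousOn_one_sub_inv_rpow hp)
    (strictMonoOn_one_sub_inv_rpow hp) hk hM hε
  refine ⟨A, hA, fun n y N hy hN => ?_⟩
  have hpos : 0 < intLpNorm p y := hA.trans_le hy
  simp_rw [intLpNorm_cons (by linarith : 0 < p) _ y hpos]
  refine (norm_sum_Ioo_natAbs_le (h := fun t : ℕ => expTwoPi (k * (intLpNorm p y *
    (1 + ((t : ℝ) / intLpNorm p y) ^ p) ^ (1 / p)))) (norm_expTwoPi _).le N).trans ?_
  have := h _ hy N hN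
  linarith

theorem norm_sum_fiber_le {ι : Type*} (u : ι → ℝ) (g : ℤ → ι) (N : ℕ) :
    ‖∑ t ∈ Finset.Ioo (-(N : ℤ)) N, expTwoPi (u (g t))‖ ≤ 2 * N := by
  refine (norm_sum_le _ _).trans ?_
  simp only [norm_expTwoPi, Finset.sum_const, Int.card_Ioo, nsmul_eq_mul, mul_one]
  have : ((N : ℤ) - -N - 1).toNat ≤ 2 * N := by omega
  exact_mod_cast this

/-- Exponential sums of a nonzero multiple of the `ℓ^p` norm over the integer points of the
Euclidean ball of radius `R` are `o(R^(n+1))` in dimension `n + 1 ≥ 2`. -/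
theorem eventually_norm_sum_intBall_le {p : ℝ} (hp : 1 < p) {k : ℝ} (hk : k ≠ 0) {n : ℕ}
    (hn : 1 ≤ n) {ε : ℝ} (hε : 0 < ε) :
    ∀ᶠ R : ℝ in atTop,
      ‖∑ z ∈ intBall (n + 1) R, expTwoPi (k * intLpNorm p z)‖ ≤ ε * R ^ (n + 1) := by
  have hn' : (0 : ℝ) < n := by exact_mod_cast hn
  -- Threshold between short and long `y`: the short ones contribute at most `4 * 5^n * c *
  -- R^(n+1)`.
  set c : ℝ := min 1 (ε / (8 * 5 ^ n)) with hc
  have hc0 : 0 < c := by positivity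
  have hc1 : c ≤ 1 := min_le_left _ _
  have hc2 : 4 * 5 ^ n * c ≤ ε / 2 := by
    have : c ≤ ε / (8 * 5 ^ n) := min_le_right _ _
    rw [le_div_iff₀ (by positivity)] at this
    linarith
  set ε' : ℝ := ε / (16 * n * 5 ^ n) with hε'
  have hε'0 : 0 < ε' := by positivity
  -- For long `y` the half chord is at most `R + 1 ≤ 2R ≤ (2/c)‖y‖_p`, hence `M = 2/c`.
  obtain ⟨A, hA, hfib⟩ := norm_sum_fiber_le_of_large hp hk (M := 2 / c) (by positivity) hε'0
  -- These give `1 ≤ cR` for the box count, `A ≤ cR` for long lines, and `5^n ≤ εR/4` to absorb the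
  -- `+ 1` of each line.
  filter_upwards [eventually_ge_atTop 1, eventually_ge_atTop (1 / c), eventually_ge_atTop (A / c),
    eventually_ge_atTop (4 * 5 ^ n / ε)] with R h1 hRc hRA hRε
  rw [div_le_iff₀ hc0] at hRc hRA
  rw [div_le_iff₀ hε] at hRε
  rw [sum_intBall_succ (by linarith)]
  classical
  have hpt : ∀ y ∈ intBox n R,
      ‖∑ t ∈ Finset.Ioo (-(halfChord R y : ℤ)) (halfChord R y),
        expTwoPi (k * intLpNorm p (Fin.cons t y : Fin (n + 1) → ℤ))‖ ≤
      (if y ∈ intBox n (c * R) then 4 * R else 0) + (4 * ε' * n * R + 1) := by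
    intro y hy
    have hN := halfChord_le (by linarith : 0 ≤ R) y
    split_ifs with hyb
    · have := norm_sum_fiber_le (fun z : Fin (n + 1) → ℤ => k * intLpNorm p z)
        (fun t => (Fin.cons t y : Fin (n + 1) → ℤ)) (halfChord R y)
      have h3 : 0 ≤ 4 * ε' * n * R := by positivity
      linarith
    · have hlow : c * R ≤ intLpNorm p y := by
        by_contra! hlt
        exact hyb (mem_intBox_of_abs_le fun i =>
          (abs_le_intLpNorm (by linarith) y i).trans hlt.le)
      have hup := intLpNorm_le hp.le hn (by linarith) (abs_le_of_mem_intBox hy)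
      have h2 := hfib n y (halfChord R y) (by linarith) (by
        calc (halfChord R y : ℝ) ≤ 2 / c * (c * R) := by
              rw [← mul_assoc, div_mul_cancel₀ _ hc0.ne']; linarith
          _ ≤ _ := by gcongr)
      have h3 : ε' * intLpNorm p y ≤ ε' * (n * (2 * R)) := by
        gcongr; refine hup.trans ?_; gcongr; linarith
      linarith
  refine (norm_sum_le _ _).trans ((Finset.sum_le_sum hpt).trans ?_)
  rw [Finset.sum_add_distrib, ← Finset.sum_filter, Finset.sum_const, Finset.sum_const,
    nsmul_eq_mul, nsmul_eq_mul]
  have hcard1 : (((intBox n R).filter (· ∈ intBox n (c * R))).card : ℝ) ≤ 5 ^ n * c * R ^ n := by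
    have hsub : (intBox n R).filter (· ∈ intBox n (c * R)) ⊆ intBox n (c * R) := fun y hy =>
      (Finset.mem_filter.1 hy).2
    have h2 : (((intBox n R).filter (· ∈ intBox n (c * R))).card : ℝ) ≤ (intBox n (c * R)).card := by
      exact_mod_cast Finset.card_le_card hsub
    refine h2.trans ((card_intBox_le (by linarith)).trans ?_)
    rw [mul_pow, mul_pow, mul_assoc]
    gcongr
    exact pow_le_of_le_one hc0.le hc1 (by omega)
  have hcard2 := card_intBox_le (n := n) h1
  rw [mul_pow] at hcard2
  have hsmall : 4 * ε' * n * R + 1 = ε / (4 * 5 ^ n) * R + 1 := by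
    rw [hε']; field_simp; ring
  have hRn : 0 ≤ R ^ n := by positivity
  calc _ ≤ 5 ^ n * c * R ^ n * (4 * R) + 5 ^ n * R ^ n * (4 * ε' * n * R + 1) := by gcongr
    _ = R ^ n * ((4 * 5 ^ n * c) * R + (ε / 4 * R + 5 ^ n)) := by
        rw [hsmall]; field_simp
    _ ≤ R ^ n * (ε / 2 * R + (ε / 4 * R + ε / 4 * R)) := by
        gcongr; linarith
    _ = _ := by ring

/-- The cube of half-side `r = R/(2n)` fits in the ball, since `n r² < R²`, and has `2⌊r⌋ + 1 ≥ r`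
integers per axis. -/
theorem le_card_intBall {n : ℕ} (hn : 1 ≤ n) {R : ℝ} (hR : 0 < R) :
    (R / (2 * n)) ^ n ≤ ((intBall n R).card : ℝ) := by
  have hn' : (1 : ℝ) ≤ n := by exact_mod_cast hn
  set r : ℝ := R / (2 * n) with hr
  have hr0 : 0 < r := by positivity
  have hfl : 0 ≤ ⌊r⌋ := Int.floor_nonneg.2 hr0.le
  have hsub : Fintype.piFinset (fun _ : Fin n => Finset.Icc (-⌊r⌋) ⌊r⌋) ⊆ intBall n R := by
    intro z hz
    rw [mem_intBall hR.le]
    have h1 : ∀ i ∈ Finset.univ, (z i : ℝ) ^ 2 ≤ r ^ 2 := fun i _ => by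
      have h2 := abs_le.2 (Finset.mem_Icc.1 (Fintype.mem_piFinset.1 hz i))
      have h3 : |(z i : ℝ)| ≤ ⌊r⌋ := by exact_mod_cast h2
      exact sq_le_sq' (abs_le.1 (h3.trans (Int.floor_le r))).1
        (abs_le.1 (h3.trans (Int.floor_le r))).2
    refine (Finset.sum_le_sum h1).trans_lt ?_
    rw [Finset.sum_const, Finset.card_univ, Fintype.card_fin, nsmul_eq_mul, hr, div_pow,
      mul_div_assoc', div_lt_iff₀ (by positivity)]
    have : (n : ℝ) * R ^ 2 < n * R ^ 2 * (4 * n) := by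
      have : 0 < n * R ^ 2 := by positivity
      nlinarith
    linarith
  have hcard : ((Fintype.piFinset (fun _ : Fin n => Finset.Icc (-⌊r⌋) ⌊r⌋)).card : ℝ) ≤
      (intBall n R).card := by exact_mod_cast Finset.card_le_card hsub
  refine le_trans ?_ hcard
  rw [Fintype.card_piFinset]
  simp only [Int.card_Icc, Finset.prod_const, Finset.card_univ, Fintype.card_fin]
  push_cast
  gcongr
  have h1 : (((⌊r⌋ + 1 - -⌊r⌋).toNat : ℤ) : ℝ) = 2 * ⌊r⌋ + 1 := by
    rw [Int.toNat_of_nonneg (by omega)]; push_cast; ring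
  rw [Int.cast_natCast] at h1
  rw [h1]
  have : (0 : ℝ) ≤ ⌊r⌋ := by exact_mod_cast hfl
  linarith [Int.lt_floor_add_one r]

theorem tendsto_average_intBall {p : ℝ} (hp : 1 < p) {k : ℝ} (hk : k ≠ 0) {n : ℕ} (hn : 2 ≤ n) :
    Tendsto (fun R : ℝ => ((intBall n R).card : ℝ)⁻¹ •
      ∑ z ∈ intBall n R, expTwoPi (k * intLpNorm p z)) atTop (𝓝 0) := by
  obtain ⟨m, rfl⟩ : ∃ m, n = m + 1 := ⟨n - 1, by omega⟩
  rw [Metric.tendsto_nhds]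
  intro ε hε
  set C : ℝ := (2 * ((m + 1 : ℕ) : ℝ)) ^ (m + 1)
  have hC : 0 < C := by positivity
  filter_upwards [eventually_gt_atTop 0, eventually_norm_sum_intBall_le hp hk
    (show 1 ≤ m by omega) (show 0 < ε / (2 * C) by positivity)] with R hR h
  have hcard := le_card_intBall (show 1 ≤ m + 1 by omega) hR
  rw [div_pow] at hcard
  have hcard0 : (0 : ℝ) < (intBall (m + 1) R).card := lt_of_lt_of_le (by positivity) hcard
  rw [dist_zero_right, norm_smul, norm_inv, Real.norm_of_nonneg hcard0.le, inv_mul_lt_iff₀ hcard0]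
  rw [div_le_iff₀ hC] at hcard
  have h2 : ε / (2 * C) * R ^ (m + 1) ≤ ε / (2 * C) * ((intBall (m + 1) R).card * C) := by gcongr
  have h3 : ε / (2 * C) * ((intBall (m + 1) R).card * C) = ε / 2 * (intBall (m + 1) R).card := by
    field_simp
  have h4 : 0 < ε / 2 * (intBall (m + 1) R).card := by positivity
  linarith

/-! ### Weyl's criterion on the circle -/

theorem integral_fourier_haarAddCircle {k : ℤ} (hk : k ≠ 0) :
    ∫ x, fourier k x ∂(AddCircle.haarAddCircle : Measure UnitAddCircle) = 0 := by
  have h := congrFun (fourierCoeff_fourier (T := 1) k) 0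
  simpa [fourierCoeff, hk] using h

/-- Weyl's criterion for measures of total mass at most `1` on the circle. -/
theorem tendsto_haarAddCircle_of_forall_fourier {γ : Type*} {l : Filter γ}
    {μ : γ → FiniteMeasure UnitAddCircle} (hμ : ∀ i, (μ i : Measure UnitAddCircle).real Set.univ ≤ 1)
    (h0 : Tendsto (fun i => ∫ x, fourier 0 x ∂(μ i : Measure UnitAddCircle)) l (𝓝 1))
    (h : ∀ k : ℤ, k ≠ 0 →
      Tendsto (fun i => ∫ x, fourier k x ∂(μ i : Measure UnitAddCircle)) l (𝓝 0)) :
    Tendsto μ l (𝓝 (⟨AddCircle.haarAddCircle, inferInstance⟩ : FiniteMeasure UnitAddCircle)) := by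
  refine (FiniteMeasure.tendsto_iff_forall_integral_rclike_tendsto ℂ).2 ?_
  set ν : Measure UnitAddCircle := AddCircle.haarAddCircle
  have hint : ∀ (m : Measure UnitAddCircle) [IsFiniteMeasure m] (g : C(UnitAddCircle, ℂ)),
      Integrable g m := fun m _ g =>
    (BoundedContinuousFunction.mkOfCompact g).integrable m
  have hspan : ∀ g ∈ Submodule.span ℂ (Set.range (fourier (T := 1))),
      Tendsto (fun i => ∫ x, g x ∂(μ i : Measure UnitAddCircle)) l (𝓝 (∫ x, g x ∂ν)) := by
    intro g hg
    induction hg using Submodule.span_induction with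
    | mem g hg =>
      obtain ⟨k, rfl⟩ := hg
      rcases eq_or_ne k 0 with rfl | hk
      · convert h0 using 2
        simp [ν]
      · rw [integral_fourier_haarAddCircle hk]
        exact h k hk
    | zero => simp [tendsto_const_nhds]
    | add f g _ _ hf hg =>
      simp only [ContinuousMap.add_apply]
      rw [integral_add (hint _ f) (hint _ g)]
      refine (hf.add hg).congr fun i => ?_
      rw [integral_add (hint _ f) (hint _ g)]
    | smul c f _ hf =>
      simp only [ContinuousMap.smul_apply, integral_smul]
      exact hf.const_smul c
  intro f
  rw [Metric.tendsto_nhds]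
  intro ε hε
  have hmem : f.toContinuousMap ∈ closure
      (Submodule.span ℂ (Set.range (fourier (T := 1))) : Set C(UnitAddCircle, ℂ)) := by
    rw [← Submodule.topologicalClosure_coe, span_fourier_closure_eq_top]
    exact Set.mem_univ _
  obtain ⟨g, hg, hfg⟩ := Metric.mem_closure_iff.1 hmem (ε / 3) (by positivity)
  -- The mass bound makes the error of the trigonometric approximation `g` uniform over all the
  -- measures.
  have hclose : ∀ m : Measure UnitAddCircle, IsFiniteMeasure m → m.real Set.univ ≤ 1 →
      dist (∫ x, f x ∂m) (∫ x, g x ∂m) ≤ ε / 3 := by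
    intro m _ hm
    rw [dist_eq_norm, ← integral_sub (f.integrable m) (hint m g)]
    refine (norm_integral_le_of_norm_le_const (C := ε / 3) (ae_of_all _ fun x => ?_)).trans ?_
    · rw [← dist_eq_norm]
      exact (ContinuousMap.dist_apply_le_dist (f := f.toContinuousMap) (g := g) x).trans hfg.le
    · nlinarith
  filter_upwards [Metric.tendsto_nhds.1 (hspan g hg) (ε / 3) (by positivity)] with i hi
  have h1 := hclose (μ i) inferInstance (hμ i)
  have h2 := hclose ν inferInstance (by simp [ν])
  have h3 := dist_triangle4_right (∫ x, f x ∂(μ i : Measure UnitAddCircle)) (∫ x, f x ∂ν)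
    (∫ x, g x ∂(μ i : Measure UnitAddCircle)) (∫ x, g x ∂ν)
  change dist _ (∫ x, f x ∂ν) < ε
  linarith

/-! ### From measures to sums over integer points -/

/-- The inclusion `ℤ^n → ℝ^n`. -/
noncomputable def intToEuclidean {n : ℕ} (z : Fin n → ℤ) : EuclideanSpace ℝ (Fin n) :=
  WithLp.toLp 2 fun i => (z i : ℝ)

theorem intToEuclidean_injective {n : ℕ} : Function.Injective (intToEuclidean (n := n)) := by
  intro z w h
  ext i
  have := congrArg (fun x : EuclideanSpace ℝ (Fin n) => x i) h
  simpa [intToEuclidean] using this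

theorem integerPoints_inter_ball_eq_image {n : ℕ} {R : ℝ} (hR : 0 < R) :
    integerPoints n ∩ (Metric.ball 0 R ∩ Set.univ) =
      ((intBall n R).map ⟨intToEuclidean, intToEuclidean_injective⟩ :
        Finset (EuclideanSpace ℝ (Fin n))) := by
  have key : ∀ z : Fin n → ℤ, intToEuclidean z ∈ Metric.ball 0 R ↔ z ∈ intBall n R := fun z => by
    rw [mem_ball_zero_iff, mem_intBall hR.le, EuclideanSpace.norm_eq, Real.sqrt_lt' hR]
    simp [intToEuclidean]
  ext x
  simp only [Set.inter_univ, Set.mem_inter_iff, Finset.coe_map, Function.Embedding.coeFn_mk,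
    Set.mem_image, Finset.mem_coe]
  constructor
  · rintro ⟨hx, hb⟩
    choose z hz using hx
    have : intToEuclidean z = x := by ext i; simp [intToEuclidean, hz]
    exact ⟨z, by rwa [← key, this], this⟩
  · rintro ⟨z, hz, rfl⟩
    exact ⟨fun i => ⟨z i, by simp [intToEuclidean]⟩, (key z).2 hz⟩

theorem integral_uniformOn_finset {Ω : Type*} [MeasurableSpace Ω] [MeasurableSingletonClass Ω]
    (s : Finset Ω) (f : Ω → ℂ) :
    ∫ x, f x ∂(ProbabilityTheory.uniformOn (s : Set Ω)) = (s.card : ℝ)⁻¹ • ∑ x ∈ s, f x := by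
  rw [ProbabilityTheory.uniformOn, ProbabilityTheory.cond, integral_smul_measure,
    setIntegral_finset]
  · simp [Measure.real]
  · rw [← Set.biUnion_of_singleton (s : Set Ω)]
    exact (integrableOn_finite_biUnion s.finite_toSet).2 fun x _ =>
      integrableOn_singleton (hx := by rw [Measure.count_singleton]; exact ENNReal.one_lt_top)

theorem integral_fourier_pushforwardMod1 {n : ℕ} {F : EuclideanSpace ℝ (Fin n) → ℝ}
    (hF : Measurable F) {R : ℝ} (hR : 0 < R) (k : ℤ) :
    ∫ x, fourier k x ∂(pushforwardMod1 Set.univ F R : Measure UnitAddCircle) =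
      ((intBall n R).card : ℝ)⁻¹ • ∑ z ∈ intBall n R, expTwoPi (k * F (intToEuclidean z)) := by
  have hmeas : Measurable fun x => (F x : UnitAddCircle) :=
    (AddCircle.continuous_mk' 1).measurable.comp hF
  change ∫ x, fourier k x ∂((ballCountingMeasure Set.univ R).map fun x => (F x : UnitAddCircle)) = _
  rw [integral_map hmeas.aemeasurable (fourier k).continuous.aestronglyMeasurable,
    ballCountingMeasure, integerPoints_inter_ball_eq_image hR, integral_uniformOn_finset,
    Finset.card_map, Finset.sum_map]
  congr 1
  refine Finset.sum_congr rfl fun z _ => ?_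
  rw [fourier_coe_apply, expTwoPi]
  congr 1
  simp only [Function.Embedding.coeFn_mk]
  push_cast
  ring

theorem real_pushforwardMod1_univ_le {n : ℕ} (D : Set (EuclideanSpace ℝ (Fin n)))
    {F : EuclideanSpace ℝ (Fin n) → ℝ} (hF : Measurable F) (R : ℝ) :
    (pushforwardMod1 D F R : Measure UnitAddCircle).real Set.univ ≤ 1 := by
  have hmeas : Measurable fun x => (F x : UnitAddCircle) :=
    (AddCircle.continuous_mk' 1).measurable.comp hF
  change ((ballCountingMeasure D R).map fun x => (F x : UnitAddCircle)).real Set.univ ≤ 1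
  rw [map_measureReal_apply hmeas MeasurableSet.univ, ballCountingMeasure]
  exact measureReal_le_one

theorem corollary1p4 (n : ℕ) (hn : 2 ≤ n) (p : ℝ) (hp : 1 < p) :
    EquidistributedMod1 (Set.univ : Set (EuclideanSpace ℝ (Fin n)))
      (fun x => (∑ i, |x i| ^ p) ^ (1 / p)) := by
  set F : EuclideanSpace ℝ (Fin n) → ℝ := fun x => (∑ i, |x i| ^ p) ^ (1 / p) with hFdef
  have hF : Measurable F := by fun_prop
  refine tendsto_haarAddCircle_of_forall_fourier (fun R => real_pushforwardMod1_univ_le _ hF R)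
    ?_ fun k hk => ?_
  -- At frequency 0 the integral is the total mass, which is exactly 1 once the ball contains an
  -- integer point.
  · refine (tendsto_const_nhds (x := (1 : ℂ))).congr' ?_
    filter_upwards [eventually_gt_atTop 0] with R hR
    rw [integral_fourier_pushforwardMod1 hF hR]
    have hcard : ((intBall n R).card : ℝ) ≠ 0 := by
      have hn' : (0 : ℝ) < n := by exact_mod_cast (by omega : 0 < n)
      have : 0 < (R / (2 * n)) ^ n := by positivity
      exact (this.trans_le (le_card_intBall (by omega) hR)).ne'
    have h1 : expTwoPi 0 = 1 := by simpa using expTwoPi_int 0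
    simp only [Int.cast_zero, zero_mul, h1, Finset.sum_const, nsmul_eq_mul, mul_one,
      Complex.real_smul]
    push_cast
    rw [inv_mul_cancel₀ (by exact_mod_cast hcard)]
  · refine (tendsto_average_intBall hp (Int.cast_ne_zero.2 hk) hn).congr' ?_
    filter_upwards [eventually_gt_atTop 0] with R hR
    rw [integral_fourier_pushforwardMod1 hF hR]
    simp [hFdef, intToEuclidean, intLpNorm]
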